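/- Fix a prime number $p$. All rings are commutative with unit. Let $R_0\xrightarrow{t_0}R_1\xrightarrow{t_1}R_2\xrightarrow{t_2}\cdots$ be a sequence of ring homomorphisms, and let $I_0$ be an ideal of $R:=R_0$. Write $\overline{R_i}:=R_i/I_0R_i$ and let $\overline{t_i}\colon\overline{R_i}\to\overline{R_{i+1}}$ be the map induced by $t_i$. An element $x\in R_i$ is called *$I_0$-torsion* if for every $a\in I_0$ there is an integer $n>0$ with $a^nx=0$; let $(R_i)_{I_0\text{-tor}}$ be the ideal of such elements. The tower $\{R_i,t_i\}_{i\ge 0}$ is a *perfectoid tower arising from $(R,I_0)$* if the following conditions hold. - **(a)** $p\in I_0$. - **(b)** For every $i\ge0$ the map $\overline{t_i}$ is injective. - **(c)** For every $i\ge0$ the image of the Frobenius $x\mapsto x^p$ of $\overline{R_{i+1}}$ is contained in the image of $\overline{t_i}$. Hence there is a unique ring homomorphism $F_i\colon\overline{R_{i+1}}\to\overline{R_i}$, the *$i$-th Frobenius projection*, with $\overline{t_i}(F_i(x))=x^p$ for all $x$. - **(d)** Every $F_i$ is surjective. - **(e)** For every $i\ge0$, $I_0R_i$ is contained in the Jacobson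 radical of $R_i$. - **(f)** $I_0$ is principal, and there is a principal ideal $I_1\subset R_1$ such that $I_1^p=I_0R_1$ and $\ker F_i=I_1\overline{R_{i+1}}$ for every $i\ge0$. - **(g)** For every $i\ge0$, $I_0\cdot(R_i)_{I_0\text{-tor}}=(0)$, and there is a bijection of sets $e_i\colon(R_{i+1})_{I_0\text{-tor}}\to(R_i)_{I_0\text{-tor}}$ such that $F_i(x\bmod I_0R_{i+1})=e_i(x)\bmod I_0R_i$ for all $x\in (R_{i+1})_{I_0\text{-tor}}$. It is called *Noetherian* if every $R_i$ is Noetherian. For $i\ge 0$ the *$i$-th small tilt* is the inverse limit $$R_i^{s.\flat}:=\varprojlim\bigl(\cdots\xrightarrow{F_{i+1}}\overline{R_{i+1}}\xrightarrow{F_i}\overline{R_i}\bigr),$$ and the tilted transition map $t_i^{s.\flat}\colon R_i^{s.\flat}\to R_{i+1}^{s.\flat}$ is the ring homomorphism $(x_m)_{m\ge0}\mapsto(\overline{t_{i+m}}(x_m))_{m\ge0}$, where $x_m\in\overline{R_{i+m}}$. Let $\{R_i,t_i\}_{i\ge0}$ be a Noetherian perfectoid tower arising from $(R,I_0)$. Then: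 1. for every $i\ge 0$, $t_i$ is flat if and only if $t_i^{s.\flat}$ is flat; 2. if $t_i$ is flat for some $i\ge0$, then $t_i$ is flat for every $i\ge0$. -/

import Mathlib

/-! Towers of rings `R 0 → R 1 → R 2 → ⋯`, given by a family `R : ℕ → Type u` of commutative rings
and transition maps `t i : R i →+* R (i + 1)`; perfectoid towers and their tilts. -/

namespace RingTower

universe u

section Tower

variable {R : ℕ → Type u} [∀ i, CommRing (R i)] (t : ∀ i, R i →+* R (i + 1))

/-- The composite `R i → R j` of transition maps, for `i ≤ j`. -/
def towerMap (i : ℕ) {j : ℕ} (h : i ≤ j) : R i →+* R j :=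
  Nat.leRec (motive := fun j _ => R i →+* R j) (RingHom.id (R i)) (fun k _ f => (t k).comp f) h

theorem towerMap_self (i : ℕ) : towerMap t i le_rfl = RingHom.id (R i) := by
  simp [towerMap]

theorem towerMap_succ {i j : ℕ} (h : i ≤ j) :
    towerMap t i (h.trans (Nat.le_succ j)) = (t j).comp (towerMap t i h) := by
  simp [towerMap, Nat.leRec_succ _ _ h]

/-- The extended ideal `I R_i`, for an ideal `I` of `R 0`. -/
def extIdeal (I : Ideal (R 0)) (i : ℕ) : Ideal (R i) :=
  I.map (towerMap t 0 (Nat.zero_le i))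

theorem extIdeal_le_comap (I : Ideal (R 0)) (i : ℕ) :
    extIdeal t I i ≤ (extIdeal t I (i + 1)).comap (t i) := by
  rw [← Ideal.map_le_iff_le_comap, extIdeal, extIdeal, Ideal.map_map, ← towerMap_succ]

/-- The quotient ring `R_i / I R_i`. -/
abbrev QuotRing (I : Ideal (R 0)) (i : ℕ) : Type u := R i ⧸ extIdeal t I i

/-- The map `R_i / I R_i → R_{i+1} / I R_{i+1}` induced by `t i`. -/
def quotMap (I : Ideal (R 0)) (i : ℕ) : QuotRing t I i →+* QuotRing t I (i + 1) :=
  Ideal.quotientMap (extIdeal t I (i + 1)) (t i) (extIdeal_le_comap t I i)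

/-- `t` is a purely inseparable tower arising from the pair `(R 0, I)`. -/
structure IsPurelyInseparable (p : ℕ) (I : Ideal (R 0)) : Prop where
  p_mem : (p : R 0) ∈ I
  quotMap_injective : ∀ i, Function.Injective (quotMap t I i)
  pow_mem_range : ∀ i (x : QuotRing t I (i + 1)), x ^ p ∈ (quotMap t I i).range

end Tower

section FrobeniusProjection

variable {R : ℕ → Type u} [∀ i, CommRing (R i)] {t : ∀ i, R i →+* R (i + 1)}
  {p : ℕ} {I : Ideal (R 0)}

theorem IsPurelyInseparable.natCast_eq_zero (h : IsPurelyInseparable t p I) (i : ℕ) :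
    (p : QuotRing t I i) = 0 := by
  have h1 : (p : R i) ∈ extIdeal t I i := by
    have h2 := Ideal.mem_map_of_mem (towerMap t 0 (Nat.zero_le i)) h.p_mem
    rwa [map_natCast] at h2
  have h2 := Ideal.Quotient.eq_zero_iff_mem.mpr h1
  simpa using h2

variable [Fact p.Prime]

/-- The `i`-th Frobenius projection `F_i : R_{i+1} / I R_{i+1} → R_i / I R_i`: the unique ring
homomorphism whose composite with the injection `R_i / I R_i → R_{i+1} / I R_{i+1}` is the
absolute Frobenius `x ↦ x ^ p`. -/
noncomputable def frobProj (h : IsPurelyInseparable t p I) (i : ℕ) :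
    QuotRing t I (i + 1) →+* QuotRing t I i where
  toFun x := (h.pow_mem_range i x).choose
  map_one' := h.quotMap_injective i (by rw [(h.pow_mem_range i 1).choose_spec]; simp)
  map_zero' := h.quotMap_injective i (by
    rw [(h.pow_mem_range i 0).choose_spec, map_zero,
      zero_pow (Fact.out : p.Prime).ne_zero])
  map_mul' x y := h.quotMap_injective i (by
    rw [map_mul, (h.pow_mem_range i (x * y)).choose_spec, (h.pow_mem_range i x).choose_spec,
      (h.pow_mem_range i y).choose_spec, mul_pow])
  map_add' x y := h.quotMap_injective i (by
    rw [map_add, (h.pow_mem_range i (x + y)).choose_spec, (h.pow_mem_range i x).choose_spec,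
      (h.pow_mem_range i y).choose_spec]
    obtain ⟨r, hr⟩ := exists_add_pow_prime_eq (Fact.out : p.Prime) x y
    rw [hr, h.natCast_eq_zero]
    ring)

theorem quotMap_frobProj (h : IsPurelyInseparable t p I) (i : ℕ) (x : QuotRing t I (i + 1)) :
    quotMap t I i (frobProj h i x) = x ^ p :=
  (h.pow_mem_range i x).choose_spec

theorem frobProj_quotMap (h : IsPurelyInseparable t p I) (i : ℕ) (x : QuotRing t I i) :
    frobProj h i (quotMap t I i x) = x ^ p :=
  h.quotMap_injective i (by rw [quotMap_frobProj, map_pow])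

theorem frobProj_quotMap_comm (h : IsPurelyInseparable t p I) (i : ℕ)
    (x : QuotRing t I (i + 1)) :
    frobProj h (i + 1) (quotMap t I (i + 1) x) = quotMap t I i (frobProj h i x) := by
  rw [frobProj_quotMap, quotMap_frobProj]

end FrobeniusProjection

/-- For a ring map `f : A → B` and an ideal `I` of `A`, the ideal of `I`-torsion elements of `B`:
those `x` such that every `a ∈ I` has a positive power killing `x`. -/
def torsionIdeal {A B : Type u} [CommRing A] [CommRing B] (f : A →+* B) (I : Ideal A) :
    Ideal B where
  carrier := {x | ∀ a ∈ I, ∃ n : ℕ, 0 < n ∧ f a ^ n * x = 0}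
  zero_mem' _ _ := ⟨1, one_pos, mul_zero _⟩
  add_mem' {x y} hx hy a ha := by
    obtain ⟨m, hm, hmx⟩ := hx a ha
    obtain ⟨n, _, hny⟩ := hy a ha
    refine ⟨m + n, by omega, ?_⟩
    rw [mul_add, pow_add, mul_right_comm, hmx, zero_mul, zero_add, mul_assoc, hny, mul_zero]
  smul_mem' c x hx a ha := by
    obtain ⟨m, hm, hmx⟩ := hx a ha
    exact ⟨m, hm, by rw [smul_eq_mul, mul_left_comm, hmx, mul_zero]⟩

section Perfectoid

variable {R : ℕ → Type u} [∀ i, CommRing (R i)] (t : ∀ i, R i →+* R (i + 1))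

/-- The ideal `(R_i)_{I-tor}` of `I`-torsion elements of `R_i`. -/
def torsionAt (I : Ideal (R 0)) (i : ℕ) : Ideal (R i) :=
  torsionIdeal (towerMap t 0 (Nat.zero_le i)) I

/-- `t` is a perfectoid tower arising from the pair `(R 0, I)`. -/
structure IsPerfectoid (p : ℕ) [Fact p.Prime] (I : Ideal (R 0)) : Prop extends
    IsPurelyInseparable t p I where
  frobProj_surjective : ∀ i, Function.Surjective (frobProj toIsPurelyInseparable i)
  zariskian : ∀ i, extIdeal t I i ≤ (⊥ : Ideal (R i)).jacobson
  principal : I.IsPrincipal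
  exists_pillar : ∃ I₁ : Ideal (R 1), I₁.IsPrincipal ∧ I₁ ^ p = extIdeal t I 1 ∧
    ∀ i, RingHom.ker (frobProj toIsPurelyInseparable i) =
      (I₁.map (towerMap t 1 (Nat.le_add_left 1 i))).map
        (Ideal.Quotient.mk (extIdeal t I (i + 1)))
  ideal_mul_torsion : ∀ i, extIdeal t I i * torsionAt t I i = ⊥
  exists_torsion_bijection : ∀ i, ∃ e : torsionAt t I (i + 1) → torsionAt t I i,
    Function.Bijective e ∧ ∀ x : torsionAt t I (i + 1),
      Ideal.Quotient.mk (extIdeal t I i) (e x : R i) =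
        frobProj toIsPurelyInseparable i
          (Ideal.Quotient.mk (extIdeal t I (i + 1)) (x : R (i + 1)))

end Perfectoid

section Tilt

variable {R : ℕ → Type u} [∀ i, CommRing (R i)] {t : ∀ i, R i →+* R (i + 1)}
  {p : ℕ} [Fact p.Prime] {I : Ideal (R 0)}

/-- The `i`-th small tilt: the inverse limit of the rings `R_j / I R_j`, `j ≥ i`, along the
Frobenius projections `F_j`. The coordinate `j = i + m` is the `m`-th projection. -/
def smallTilt (h : IsPurelyInseparable t p I) (i : ℕ) :
    Subring (∀ j : {j : ℕ // i ≤ j}, QuotRing t I j) where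
  carrier := {x | ∀ (j : ℕ) (hj : i ≤ j),
    frobProj h j (x ⟨j + 1, hj.trans (Nat.le_succ j)⟩) = x ⟨j, hj⟩}
  zero_mem' _ _ := map_zero _
  one_mem' _ _ := map_one _
  add_mem' hx hy j hj := by
    simp only [Pi.add_apply, map_add]
    rw [hx j hj, hy j hj]
  mul_mem' hx hy j hj := by
    simp only [Pi.mul_apply, map_mul]
    rw [hx j hj, hy j hj]
  neg_mem' hx j hj := by
    simp only [Pi.neg_apply, map_neg]
    rw [hx j hj]

/-- The map induced on all coordinates by `t`: the coordinate in `R_{j+1} / I R_{j+1}` of the image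
is the image of the coordinate in `R_j / I R_j` under the map induced by `t j`. -/
def tiltMapFun (t : ∀ i, R i →+* R (i + 1)) (I : Ideal (R 0)) (i : ℕ)
    (x : ∀ j : {j : ℕ // i ≤ j}, QuotRing t I j) :
    ∀ j : {j : ℕ // i + 1 ≤ j}, QuotRing t I j
  | ⟨0, hj⟩ => absurd hj (Nat.not_succ_le_zero i)
  | ⟨j + 1, hj⟩ => quotMap t I j (x ⟨j, Nat.le_of_succ_le_succ hj⟩)

theorem tiltMapFun_mem (h : IsPurelyInseparable t p I) (i : ℕ)
    (x : ∀ j : {j : ℕ // i ≤ j}, QuotRing t I j) (hx : x ∈ smallTilt h i) :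
    tiltMapFun t I i x ∈ smallTilt h (i + 1) := by
  rintro (_ | j) hj
  · exact absurd hj (Nat.not_succ_le_zero i)
  · have hx' := hx j (Nat.le_of_succ_le_succ hj)
    change frobProj h (j + 1) (quotMap t I (j + 1) (x ⟨j + 1, _⟩)) = quotMap t I j (x ⟨j, _⟩)
    rw [frobProj_quotMap_comm, hx']

/-- The transition map of the tilt, from the `i`-th small tilt to the `(i+1)`-st: the ring
homomorphism compatible, through the `m`-th projections, with the maps
`R_{i+m} / I R_{i+m} → R_{i+m+1} / I R_{i+m+1}` induced by `t (i + m)`. -/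
def smallTiltMap (h : IsPurelyInseparable t p I) (i : ℕ) :
    smallTilt h i →+* smallTilt h (i + 1) where
  toFun x := ⟨tiltMapFun t I i x.1, tiltMapFun_mem h i x.1 x.2⟩
  map_one' := by
    ext ⟨_ | j, hj⟩
    · exact absurd hj (Nat.not_succ_le_zero i)
    · exact map_one (quotMap t I j)
  map_zero' := by
    ext ⟨_ | j, hj⟩
    · exact absurd hj (Nat.not_succ_le_zero i)
    · exact map_zero (quotMap t I j)
  map_mul' x y := by
    ext ⟨_ | j, hj⟩
    · exact absurd hj (Nat.not_succ_le_zero i)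
    · exact map_mul (quotMap t I j) _ _
  map_add' x y := by
    ext ⟨_ | j, hj⟩
    · exact absurd hj (Nat.not_succ_le_zero i)
    · exact map_add (quotMap t I j) _ _

end Tilt

end RingTower

/-!
# Flatness of the transition maps of a Noetherian perfectoid tower and of its tilt

Both statements follow from one: each `t i` is flat if and only if the Frobenius of the `0`-th small
tilt `T` is flat. Indeed, forgetting coordinates identifies `T` with every small tilt, and every
transition map of the tilt with the Frobenius of `T` (`RingTower.flat_smallTiltMap_iff`).

For a homomorphism `A → B` of Noetherian rings and `f : A` whose image lies in the Jacobson radical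
of `B`, the local criterion says that `A → B` is flat if and only if `A / f → B / f` is flat and the
`f`-torsion of `B` is generated by that of `A`. If `f ^ 2` kills no more of `B` than `f` does, the
second condition can be read off from the images of the torsion in `A / f` and `B / f`
(`RingHom.flat_iff_flat_mod_and_torsionBy_le`).

This applies to `t i`, with `f` a generator of `I`, and to the Frobenius of `T`, with `f = g ^ p ^ i`
for an element `g` of `T` whose power `g ^ p ^ i` generates the kernel of `T → R_i / I R_i`
(`RingTower.IsTiltUniformizer.ker_tiltProj`). The ring `T` is reduced, and it is complete along `g`
with Noetherian quotient `R 0 / I`, hence Noetherian. In both cases the reduction is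
`R_i / I R_i → R_{i+1} / I R_{i+1}`, and the images of the torsion agree
(`RingTower.IsPerfectoid.exists_isTiltUniformizer_and_map_torsionBy`), because the Frobenius
projections are bijective on torsion classes.
-/

/-! ### The local criterion of flatness along a principal ideal -/

open scoped TensorProduct

section LocalCriterion

variable {A B : Type*} [CommRing A] [CommRing B] [Algebra A B]

/-- An element of the extension `N B` comes from `B ⊗ N`; the tensor is compared with `B` through
the identification `B ⊗ A ≃ B`. -/
theorem exists_baseChange_subtype_eq_of_mem_map (N : Ideal A) {b : B}
    (hb : b ∈ N.map (algebraMap A B)) :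
    ∃ w : B ⊗[A] N, (Algebra.TensorProduct.rid A B B) (N.subtype.baseChange B w) = b := by
  induction hb using Submodule.span_induction with
  | mem b hb =>
    obtain ⟨a, ha, rfl⟩ := hb
    exact ⟨1 ⊗ₜ ⟨a, ha⟩, by simp [Algebra.smul_def]⟩
  | zero => exact ⟨0, by simp⟩
  | add x y _ _ hx hy =>
    obtain ⟨w, rfl⟩ := hx
    obtain ⟨v, rfl⟩ := hy
    exact ⟨w + v, by simp⟩
  | smul c x _ hx =>
    obtain ⟨w, rfl⟩ := hx
    exact ⟨c • w, by simp⟩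

/-- The colon ideal `(N : f)`, as the preimage of `N` under multiplication by `f`. -/
def colonElem (f : A) (N : Ideal A) : Ideal A := Submodule.comap (LinearMap.lsmul A A f) N

theorem mem_colonElem {f : A} {N : Ideal A} {x : A} : x ∈ colonElem f N ↔ f * x ∈ N := Iff.rfl

theorem le_colonElem (f : A) (N : Ideal A) : N ≤ colonElem f N := fun _ hx => N.mul_mem_left f hx

/-- Multiplication by `f`, as a map `(N : f) → N`. -/
def mulColon (f : A) (N : Ideal A) : colonElem f N →ₗ[A] N :=
  (LinearMap.lsmul A A f).restrict fun _ hx => hx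

theorem mulColon_apply (f : A) (N : Ideal A) (x : colonElem f N) :
    mulColon f N x = ⟨f * x, x.2⟩ := rfl

/-- The kernel of `B ⊗ N → B` is the image under multiplication by `f` of the kernel of
`B ⊗ (N : f) → B`. The hypothesis `hmod` says that relations of `B` modulo `f` are trivial, that is,
that `B / f B` is flat over `A / f A`, by the equational criterion; `htor` says that the `f`-torsion
of `B` is generated by that of `A`, that is, that `Tor₁ (A / f A, B)` vanishes. -/
theorem exists_mulColon_eq_of_baseChange_subtype_eq_zero (f : A)
    (hmod : ∀ (l : ℕ) (a : Fin l → A) (b : Fin l → B),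
      ∑ i, a i • b i ∈ Ideal.span {algebraMap A B f} →
      ∃ (k : ℕ) (c : Fin l → Fin k → A) (y : Fin k → B),
        (∀ i, b i - ∑ j, c i j • y j ∈ Ideal.span {algebraMap A B f}) ∧
        ∀ j, ∑ i, a i * c i j ∈ Ideal.span {f})
    (htor : Submodule.torsionBy B B (algebraMap A B f) ≤
      Ideal.map (algebraMap A B) (Submodule.torsionBy A A f))
    (N : Ideal A) (x : B ⊗[A] N) (hx : N.subtype.baseChange B x = 0) :
    ∃ x' : B ⊗[A] (colonElem f N), (colonElem f N).subtype.baseChange B x' = 0 ∧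
      (mulColon f N).baseChange B x' = x := by
  obtain ⟨l, b, a, rfl⟩ := TensorProduct.exists_sum_tmul_eq x
  have hx0 : ∑ i, (a i : A) • b i = 0 := by
    simpa using congrArg (Algebra.TensorProduct.rid A B B) hx
  obtain ⟨k, c, y, hy, hc⟩ := hmod l (fun i => a i) b (by rw [hx0]; exact zero_mem _)
  choose b' hb' using fun i => Ideal.mem_span_singleton'.mp (hy i)
  choose d hd using fun j => Ideal.mem_span_singleton'.mp (hc j)
  have hdN (j) : d j ∈ colonElem f N := by
    rw [mem_colonElem, mul_comm, hd]
    exact sum_mem fun i _ => N.mul_mem_right _ (a i).2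
  have hb (i) : b i = ∑ j, c i j • y j + f • b' i := by
    rw [Algebra.smul_def, mul_comm, hb']; ring
  -- Dividing the relation `∑ a i • b i = 0` by `f` leaves an `f`-torsion element `s`, which is
  -- corrected by the torsion of `A`.
  set s : B := ∑ j, d j • y j + ∑ i, (a i : A) • b' i with hs
  have hfs : f • s = 0 := by
    have : f • s = ∑ i, (a i : A) • b i := by
      simp only [hb, hs, smul_add, Finset.smul_sum, Finset.sum_add_distrib, smul_smul]
      rw [Finset.sum_comm]
      congr 1
      · refine Finset.sum_congr rfl fun j _ => ?_
        rw [mul_comm, hd, Finset.sum_smul]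
      · simp only [mul_comm]
    rw [this, hx0]
  obtain ⟨w, hw⟩ := exists_baseChange_subtype_eq_of_mem_map _
    (htor ((Submodule.mem_torsionBy_iff _ _).mpr (by rwa [smul_eq_mul, ← Algebra.smul_def])))
  have hle : (Submodule.torsionBy A A f : Ideal A) ≤ colonElem f N := fun e he => by
    rw [Submodule.mem_torsionBy_iff, smul_eq_mul] at he
    rw [mem_colonElem, he]; exact zero_mem _
  refine ⟨∑ j, y j ⊗ₜ ⟨d j, hdN j⟩ + ∑ i, b' i ⊗ₜ ⟨a i, le_colonElem f N (a i).2⟩ -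
    (Submodule.inclusion hle).baseChange B w, ?_, ?_⟩
  · apply (Algebra.TensorProduct.rid A B B).injective
    have h1 : (colonElem f N).subtype.baseChange B ((Submodule.inclusion hle).baseChange B w) =
        (Submodule.torsionBy A A f).subtype.baseChange B w := by
      rw [← LinearMap.comp_apply, ← LinearMap.baseChange_comp]; rfl
    rw [map_sub, h1, map_sub, hw]
    simp [hs]
  · have h1 : (mulColon f N).baseChange B ((Submodule.inclusion hle).baseChange B w) = 0 := by
      rw [← LinearMap.comp_apply, ← LinearMap.baseChange_comp]
      have : mulColon f N ∘ₗ Submodule.inclusion hle = 0 := by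
        ext e
        simpa [mulColon_apply] using (Submodule.mem_torsionBy_iff _ _).mp e.2
      simp [this]
    rw [map_sub, h1, sub_zero]
    simp only [map_add, map_sum, LinearMap.baseChange_tmul, mulColon_apply]
    have h2 (j) : (⟨f * d j, hdN j⟩ : N) = ∑ i, c i j • a i := by
      ext
      simp only [AddSubmonoidClass.coe_finsetSum, SetLike.val_smul, smul_eq_mul]
      rw [mul_comm, hd]
      exact Finset.sum_congr rfl fun i _ => mul_comm _ _
    have h3 (i) : (⟨f * a i, le_colonElem f N (a i).2⟩ : N) = f • a i := rfl
    simp only [hb, h2, h3, TensorProduct.tmul_sum, TensorProduct.add_tmul, TensorProduct.sum_tmul,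
      Finset.sum_add_distrib, TensorProduct.tmul_smul, TensorProduct.smul_tmul']
    rw [Finset.sum_comm]

/-- **Local criterion of flatness** along a principal ideal; `hmod` expresses in elements that
`B / f B` is flat over `A / f A`, and `htor` that `Tor₁ (A / f A, B)` vanishes. The injectivity of
`B ⊗ N → B` is proved by Noetherian induction on the ideal `N`: its kernel is controlled by that of
the ideal `(N : f)` if this is larger, and vanishes by Nakayama's lemma if `(N : f) = N`. -/
theorem flat_of_flat_mod_of_torsionBy_le [IsNoetherianRing A] [IsNoetherianRing B] (f : A)
    (hf : algebraMap A B f ∈ (⊥ : Ideal B).jacobson)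
    (hmod : ∀ (l : ℕ) (a : Fin l → A) (b : Fin l → B),
      ∑ i, a i • b i ∈ Ideal.span {algebraMap A B f} →
      ∃ (k : ℕ) (c : Fin l → Fin k → A) (y : Fin k → B),
        (∀ i, b i - ∑ j, c i j • y j ∈ Ideal.span {algebraMap A B f}) ∧
        ∀ j, ∑ i, a i * c i j ∈ Ideal.span {f})
    (htor : Submodule.torsionBy B B (algebraMap A B f) ≤
      Ideal.map (algebraMap A B) (Submodule.torsionBy A A f)) :
    Module.Flat A B := by
  have key (N : Ideal A) : Function.Injective (N.subtype.baseChange B) := by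
    induction N using WellFoundedGT.induction with
    | ind N ih =>
    have hex := exists_mulColon_eq_of_baseChange_subtype_eq_zero f hmod htor N
    rw [← LinearMap.ker_eq_bot]
    rcases (le_colonElem f N).lt_or_eq with hlt | heq
    · refine LinearMap.ker_eq_bot'.mpr fun x hx => ?_
      obtain ⟨x', hx', rfl⟩ := hex x hx
      rw [LinearMap.ker_eq_bot'.mp (LinearMap.ker_eq_bot.mpr (ih _ hlt)) x' hx', map_zero]
    · refine Submodule.eq_bot_of_le_smul_of_le_jacobson_bot (Ideal.span {algebraMap A B f}) _
        (IsNoetherian.noetherian _) (fun x hx => ?_)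
        ((Ideal.span_singleton_le_iff_mem _).mpr hf)
      obtain ⟨x', hx', hxx⟩ := hex x hx
      have h1 : mulColon f N = f • Submodule.inclusion heq.ge := rfl
      rw [h1, LinearMap.baseChange_smul, LinearMap.smul_apply] at hxx
      rw [← hxx, ← algebraMap_smul B f]
      refine Submodule.smul_mem_smul (Ideal.mem_span_singleton_self _) ?_
      rw [LinearMap.mem_ker, ← LinearMap.comp_apply, ← LinearMap.baseChange_comp]
      exact hx'
  exact Module.Flat.iff_lTensor_injective'.mpr fun N => key N

end LocalCriterion

/-! ### Noetherianity of complete rings -/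

/-- A ring that is complete along a principal ideal with Noetherian quotient is Noetherian. -/
theorem isNoetherianRing_of_isAdicComplete_span_singleton {T : Type*} [CommRing T] (g : T)
    [IsAdicComplete (Ideal.span {g}) T] [IsNoetherianRing (T ⧸ Ideal.span {g})] :
    IsNoetherianRing T := by
  classical
  refine IsNoetherianRing.of_prime fun P hP => ?_
  -- By Noetherianity of the quotient, finitely many elements of `P` generate it modulo `g`.
  obtain ⟨S, hSP, hS⟩ : ∃ S : Finset T, (S : Set T) ⊆ P ∧
      P ≤ Ideal.span S ⊔ Ideal.span {g} := by
    obtain ⟨s', hs', hspan⟩ := Submodule.fg_span_iff_fg_span_finset_subset _ |>.mp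
      (IsNoetherian.noetherian (P.map (Ideal.Quotient.mk (Ideal.span {g}))))
    obtain ⟨S, hSP, rfl⟩ := Finset.subset_set_image_iff.mp hs'
    refine ⟨S, hSP, ?_⟩
    have h1 : P.map (Ideal.Quotient.mk (Ideal.span {g})) =
        (Ideal.span (S : Set T)).map (Ideal.Quotient.mk (Ideal.span {g})) := by
      rw [Ideal.map_span, ← Finset.coe_image]; exact hspan
    have h2 := Ideal.le_comap_of_map_le h1.le
    rwa [Ideal.comap_map_of_surjective _ Ideal.Quotient.mk_surjective,
      ← RingHom.ker_eq_comap_bot, Ideal.mk_ker] at h2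
  by_cases hg : g ∈ P
  · refine ⟨insert g S, le_antisymm ?_ ?_⟩
    · rw [Submodule.span_le, Finset.coe_insert]
      exact Set.insert_subset hg hSP
    · rw [Finset.coe_insert, ← Set.singleton_union, sup_comm] at *
      exact hS.trans_eq (Ideal.span_union _ _).symm
  · refine ⟨S, le_antisymm (Submodule.span_le.mpr hSP) fun y hy => ?_⟩
    -- Since `g ∉ P`, the part divisible by `g` of an element of `P` is again `g` times an element
    -- of `P`, so that elements of `P` can be expanded as power series in `g`.
    have hex (d : P) : ∃ (c : T → T) (d' : P), (d : T) = ∑ x ∈ S, c x * x + g * d' := by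
      obtain ⟨u, hu, v, hv, huv⟩ := Submodule.mem_sup.mp (hS d.2)
      obtain ⟨c, -, rfl⟩ := Submodule.mem_span_finset.mp hu
      obtain ⟨d', rfl⟩ := Ideal.mem_span_singleton.mp hv
      refine ⟨c, ⟨d', (hP.mem_or_mem ?_).resolve_left hg⟩, huv.symm⟩
      rw [← eq_sub_iff_add_eq'] at huv
      rw [huv]
      exact P.sub_mem d.2 (Submodule.span_le.mpr hSP hu)
    choose c next hnext using hex
    let d : ℕ → P := fun n => next^[n] ⟨y, hy⟩
    have hd (n) : d (n + 1) = next (d n) := Function.iterate_succ_apply' _ _ _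
    have hpart (n : ℕ) : y = ∑ x ∈ S, (∑ m ∈ Finset.range n, g ^ m * c (d m) x) * x +
        g ^ n * d n := by
      induction n with
      | zero => simp [d]
      | succ n ih =>
        simp only [Finset.sum_range_succ, add_mul, Finset.sum_add_distrib]
        nth_rewrite 1 [ih]
        rw [hnext (d n), hd, mul_add, Finset.mul_sum, pow_succ]
        simp only [mul_assoc, add_assoc]
    have hmem (n : ℕ) (u : T) : u ∈ (Ideal.span {g} ^ n • ⊤ : Ideal T) ↔ g ^ n ∣ u := by
      rw [smul_eq_mul, Ideal.mul_top, Ideal.span_singleton_pow, Ideal.mem_span_singleton]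
    have hlim (x : T) : ∃ L : T, ∀ n, g ^ n ∣ ∑ m ∈ Finset.range n, g ^ m * c (d m) x - L := by
      obtain ⟨L, hL⟩ := IsPrecomplete.prec (I := Ideal.span {g}) (M := T) inferInstance
        (f := fun n => ∑ m ∈ Finset.range n, g ^ m * c (d m) x) (fun {m n} hmn => by
          rw [SModEq.comm, SModEq.sub_mem, hmem, Finset.sum_range_sub_sum_range hmn]
          exact Finset.dvd_sum fun i hi => Dvd.dvd.mul_right
            (pow_dvd_pow _ (Finset.mem_filter.mp hi).2) _)
      exact ⟨L, fun n => by rw [← hmem, ← SModEq.sub_mem]; exact hL n⟩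
    choose L hL using hlim
    have hyL : y - ∑ x ∈ S, L x * x = 0 := by
      refine IsHausdorff.haus (I := Ideal.span {g}) inferInstance _ fun n => ?_
      rw [SModEq.zero, hmem]
      nth_rewrite 1 [hpart n]
      rw [add_sub_right_comm, ← Finset.sum_sub_distrib]
      refine dvd_add (Finset.dvd_sum fun x _ => ?_) (dvd_mul_right _ _)
      rw [← sub_mul]
      exact (hL x n).mul_right _
    rw [sub_eq_zero.mp hyL]
    exact sum_mem fun x hx => Ideal.mul_mem_left _ _ (Ideal.subset_span hx)

/-! ### Flatness in terms of the reduction -/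

section FlatIff

variable {A B A' B' : Type*} [CommRing A] [CommRing B] [CommRing A'] [CommRing B']

/-- The flatness of `φ` is determined by its reduction `φ'` modulo `f` and the images of the
`f`-torsion of `A` and `B` in the reductions. If the square of `φ f` kills no more than `φ f`
(hypothesis `hB`), then the torsion of `B` meets `f B` trivially, so that it can be recovered from
its image. -/
theorem RingHom.flat_iff_flat_mod_and_torsionBy_le [IsNoetherianRing A] [IsNoetherianRing B]
    (φ : A →+* B) (φ' : A' →+* B') (α : A →+* A') (β : B →+* B')
    (hα : Function.Surjective α) (hβ : Function.Surjective β)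
    (hcomm : β.comp φ = φ'.comp α) (f : A)
    (hkα : RingHom.ker α = Ideal.span {f}) (hkβ : RingHom.ker β = Ideal.span {φ f})
    (hf : φ f ∈ (⊥ : Ideal B).jacobson)
    (hB : ∀ b : B, φ f * (φ f * b) = 0 → φ f * b = 0) :
    φ.Flat ↔ φ'.Flat ∧ Ideal.map β (Submodule.torsionBy B B (φ f)) ≤
      Ideal.map φ' (Ideal.map α (Submodule.torsionBy A A f)) := by
  algebraize [φ, φ']
  have hc (a) : β (φ a) = φ' (α a) := RingHom.congr_fun hcomm a
  have hα0 {a} : α a = 0 ↔ a ∈ Ideal.span {f} := by rw [← hkα, RingHom.mem_ker]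
  have hβ0 {b} : β b = 0 ↔ b ∈ Ideal.span {φ f} := by rw [← hkβ, RingHom.mem_ker]
  have hmap : Ideal.map φ' (Ideal.map α (Submodule.torsionBy A A f)) =
      Ideal.map β (Ideal.map φ (Submodule.torsionBy A A f)) := by
    rw [Ideal.map_map, Ideal.map_map, hcomm]
  have htorle : Ideal.map φ (Submodule.torsionBy A A f) ≤ Submodule.torsionBy B B (φ f) := by
    rw [Ideal.map_le_iff_le_comap]
    intro a ha
    rw [Submodule.mem_torsionBy_iff, smul_eq_mul] at ha
    rw [Ideal.mem_comap, Submodule.mem_torsionBy_iff, smul_eq_mul, ← map_mul, ha, map_zero]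
  constructor
  · intro hφ
    have hφ : Module.Flat A B := hφ
    constructor
    · change Module.Flat A' B'
      refine Module.Flat.of_forall_isTrivialRelation fun {l a' b'} h => ?_
      choose a ha using fun i => hα (a' i)
      choose b hb using fun i => hβ (b' i)
      have hmem : β (∑ i, φ (a i) * b i) = 0 := by
        simp only [map_sum, map_mul, hc, ha, hb]
        simpa only [Algebra.smul_def] using! h
      obtain ⟨d, hd⟩ := Ideal.mem_span_singleton.mp (hβ0.mp hmem)
      obtain ⟨k, c, y, hy, hcy⟩ := Module.Flat.isTrivialRelation_of_sum_smul_eq_zero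
        (R := A) (f := (Fin.cons (-f) a : Fin (l + 1) → A)) (x := Fin.cons d b) (by
          simp only [Fin.sum_univ_succ, Fin.cons_zero, Fin.cons_succ, Algebra.smul_def]
          change φ (-f) * d + ∑ i, φ (a i) * b i = 0
          rw [hd, map_neg]; ring)
      refine ⟨k, fun i j => α (c i.succ j), fun j => β (y j), fun i => ?_, fun j => ?_⟩
      · have := congrArg β (hy i.succ)
        simp only [Fin.cons_succ, hb, map_sum, Algebra.smul_def, map_mul] at this ⊢
        rw [this]
        exact Finset.sum_congr rfl fun j _ => congrArg (· * _) (hc _)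
      · have := congrArg α (hcy j)
        simp only [Fin.sum_univ_succ, Fin.cons_zero, Fin.cons_succ, map_add, map_mul, map_neg,
          map_sum, ha, map_zero, hα0.mpr (Ideal.mem_span_singleton_self f)] at this
        simpa using this
    · rw [hmap]
      refine Ideal.map_mono fun b hb => ?_
      obtain ⟨k, c, y, hy, hcy⟩ := Module.Flat.isTrivialRelation_of_sum_smul_eq_zero
        (R := A) (f := fun _ : Fin 1 => f) (x := fun _ => b) (by simpa [Algebra.smul_def] using! hb)
      rw [show b = _ from hy 0]
      refine sum_mem fun j _ => ?_
      rw [Algebra.smul_def]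
      refine Ideal.mul_mem_right _ _ (Ideal.mem_map_of_mem φ ?_)
      simpa [Submodule.mem_torsionBy_iff] using hcy j
  · rintro ⟨hφ', hN⟩
    have hφ' : Module.Flat A' B' := hφ'
    refine flat_of_flat_mod_of_torsionBy_le (A := A) (B := B) f hf (fun l a b h => ?_) ?_
    · obtain ⟨k, c, y, hy, hcy⟩ := Module.Flat.isTrivialRelation_of_sum_smul_eq_zero
        (R := A') (f := fun i => α (a i)) (x := fun i => β (b i)) (by
          have := hβ0.mpr h
          simp only [Algebra.smul_def, map_sum, map_mul] at this ⊢
          rw [← this]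
          exact Finset.sum_congr rfl fun i _ => congrArg (· * _) (hc _).symm)
      choose c' hc' using fun i j => hα (c i j)
      choose y' hy' using fun j => hβ (y j)
      refine ⟨k, c', y', fun i => ?_, fun j => ?_⟩
      · refine hβ0.mp ?_
        rw [map_sub, show β (b i) = _ from hy i, sub_eq_zero, map_sum]
        refine Finset.sum_congr rfl fun j _ => ?_
        rw [Algebra.smul_def, Algebra.smul_def, map_mul, hy', ← hc']
        exact congrArg (· * _) (hc _).symm
      · refine hα0.mp ?_
        simpa only [map_sum, map_mul, hc'] using hcy j
    · intro b hb
      have h1 := hN (Ideal.mem_map_of_mem β hb)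
      rw [hmap, Ideal.mem_map_iff_of_surjective β hβ] at h1
      obtain ⟨b', hb', hbb⟩ := h1
      obtain ⟨d, hd⟩ := Ideal.mem_span_singleton.mp (hβ0.mp (show β (b - b') = 0 by
        rw [map_sub, hbb, sub_self]))
      have h2 : φ f * (b - b') = 0 := Submodule.sub_mem _ hb (htorle hb')
      have h3 : b = b' := by
        rw [← sub_eq_zero, hd]
        exact hB d (by rw [← hd, h2])
      rw [h3]
      exact hb'

end FlatIff

namespace RingTower

universe u

variable {R : ℕ → Type u} [∀ i, CommRing (R i)] {t : ∀ i, R i →+* R (i + 1)}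
  {p : ℕ} {I : Ideal (R 0)}

/-! ### The tilt and its Frobenius -/

theorem towerMap_comp_towerMap (i : ℕ) {j k : ℕ} (hij : i ≤ j) (hjk : j ≤ k) :
    (towerMap t j hjk).comp (towerMap t i hij) = towerMap t i (hij.trans hjk) := by
  induction k, hjk using Nat.le_induction with
  | base => rw [towerMap_self, RingHom.id_comp]
  | succ k hjk ih =>
    rw [towerMap_succ t hjk, towerMap_succ t (hij.trans hjk), RingHom.comp_assoc, ih]

/-- The `p`-power map as a ring endomorphism of a ring in which `p = 0`. Unlike `frobenius`, it
does not require the characteristic to be exactly `p`, so the zero ring is allowed. -/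
def powHom [Fact p.Prime] {S : Type*} [CommRing S] (hp : (p : S) = 0) : S →+* S where
  toFun x := x ^ p
  map_one' := one_pow p
  map_zero' := zero_pow (Fact.out : p.Prime).ne_zero
  map_mul' x y := mul_pow x y p
  map_add' x y := by
    obtain ⟨r, hr⟩ := exists_add_pow_prime_eq (Fact.out : p.Prime) x y
    rw [hr, hp]
    ring

variable [Fact p.Prime] (h : IsPurelyInseparable t p I)

/-- The `j`-th projection of the `0`-th small tilt. -/
def tiltProj (j : ℕ) : smallTilt h 0 →+* QuotRing t I j :=
  (Pi.evalRingHom (fun j : {j : ℕ // 0 ≤ j} => QuotRing t I j) ⟨j, Nat.zero_le j⟩).comp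
    (smallTilt h 0).subtype

theorem frobProj_tiltProj (j : ℕ) (x : smallTilt h 0) :
    frobProj h j (tiltProj h (j + 1) x) = tiltProj h j x :=
  x.2 j (Nat.zero_le j)

variable {h} in
theorem tilt_ext {x y : smallTilt h 0} (hxy : ∀ j, tiltProj h j x = tiltProj h j y) : x = y :=
  Subtype.ext (funext fun j => hxy j)

theorem exists_tiltProj_eq (s : ∀ j, QuotRing t I j)
    (hs : ∀ j, frobProj h j (s (j + 1)) = s j) :
    ∃ x : smallTilt h 0, ∀ j, tiltProj h j x = s j :=
  ⟨⟨fun j => s j, fun j _ => hs j⟩, fun _ => rfl⟩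

theorem tiltProj_succ_pow (j : ℕ) (x : smallTilt h 0) :
    tiltProj h (j + 1) x ^ p = quotMap t I j (tiltProj h j x) := by
  rw [← frobProj_tiltProj h j, quotMap_frobProj]

theorem natCast_smallTilt_eq_zero (i : ℕ) : (p : smallTilt h i) = 0 :=
  Subtype.ext (funext fun j => h.natCast_eq_zero j)

/-- The tilt is reduced: its Frobenius is given in coordinates by the injections induced by `t`,
up to a shift. -/
instance isReduced_smallTilt_zero : IsReduced (smallTilt h 0) := by
  refine (isReduced_iff_pow_one_lt p (Fact.out : p.Prime).one_lt).mpr fun x hx => ?_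
  refine tilt_ext fun j => h.quotMap_injective j ?_
  rw [← tiltProj_succ_pow, ← map_pow, hx, map_zero, map_zero, map_zero]

/-- Forgetting the coordinates below `i` is a ring homomorphism from the `0`-th to the `i`-th small
tilt. -/
def tiltDrop (i : ℕ) : smallTilt h 0 →+* smallTilt h i where
  toFun x := ⟨fun j => tiltProj h j x, fun j _ => frobProj_tiltProj h j x⟩
  map_one' := rfl
  map_zero' := rfl
  map_mul' _ _ := rfl
  map_add' _ _ := rfl

/-- The coordinates below `i` are determined by the others, through the Frobenius projections. -/
theorem tiltDrop_bijective (i : ℕ) : Function.Bijective (tiltDrop h i) := by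
  have hinj : ∀ (i : ℕ) (x : smallTilt h 0), tiltDrop h i x = 0 → x = 0 := fun i x hx => by
    have hge (j) (hj : i ≤ j) : tiltProj h j x = 0 :=
      congrFun (congrArg Subtype.val hx) ⟨j, hj⟩
    have hle : ∀ k j, i ≤ j + k → tiltProj h j x = 0 := fun k => by
      induction k with
      | zero => exact hge
      | succ k ih =>
        intro j hj
        rw [← frobProj_tiltProj, ih (j + 1) (by omega), map_zero]
    exact tilt_ext fun j => by rw [hle i j (by omega), map_zero]
  refine ⟨(injective_iff_map_eq_zero _).mpr (hinj i), ?_⟩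
  induction i with
  | zero => exact fun y => ⟨y, rfl⟩
  | succ i ih =>
    intro y
    -- The coordinate `i` is recovered from the coordinate `i + 1`.
    obtain ⟨x, hx⟩ := ih ⟨fun j => frobProj h j (y.1 ⟨j + 1, Nat.succ_le_succ j.2⟩),
      fun j hj => congrArg (frobProj h j) (y.2 (j + 1) (Nat.succ_le_succ hj))⟩
    refine ⟨x, Subtype.ext (funext fun j => ?_)⟩
    have h1 : tiltProj h j x = frobProj h j (y.1 ⟨j + 1, by have := j.2; omega⟩) :=
      congrFun (congrArg Subtype.val hx) ⟨j, by have := j.2; omega⟩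
    exact h1.trans (y.2 j j.2)

/-- Under the identification of all small tilts with the `0`-th one, every transition map of the tilt
becomes the Frobenius. -/
theorem smallTiltMap_comp_tiltDrop (i : ℕ) :
    (smallTiltMap h i).comp (tiltDrop h i) =
      (tiltDrop h (i + 1)).comp (powHom (natCast_smallTilt_eq_zero h 0)) := by
  ext x ⟨_ | j, hj⟩
  · exact absurd hj (Nat.not_succ_le_zero i)
  · change quotMap t I j (tiltProj h j x) = tiltProj h (j + 1) (x ^ p)
    rw [map_pow, tiltProj_succ_pow]

theorem flat_smallTiltMap_iff (i : ℕ) :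
    (smallTiltMap h i).Flat ↔ (powHom (natCast_smallTilt_eq_zero h 0)).Flat := by
  rw [← RingHom.Flat.comp_iff_of_bijective_right (tiltDrop_bijective h i),
    smallTiltMap_comp_tiltDrop, RingHom.Flat.comp_iff_of_bijective_left (tiltDrop_bijective h _)]

/-- If the Frobenius projections map each set `S (j + 1)` onto `S j`, then every element of `S i`
is a coordinate of an element of the tilt with all its coordinates in the sets `S j`. -/
theorem exists_tiltProj_eq_and_forall_mem (S : ∀ j, Set (QuotRing t I j))
    (hS : ∀ j, frobProj h j '' S (j + 1) = S j) (i : ℕ) {y : QuotRing t I i} (hy : y ∈ S i) :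
    ∃ x : smallTilt h 0, tiltProj h i x = y ∧ ∀ j, tiltProj h j x ∈ S j := by
  have hlift (j) (z : S j) : ∃ w : S (j + 1), frobProj h j w = z := by
    obtain ⟨w, hw, hwz⟩ := (hS j).ge z.2
    exact ⟨⟨w, hw⟩, hwz⟩
  choose lift hlift using hlift
  let v (j : ℕ) (hj : i ≤ j) : S j :=
    Nat.leRec (motive := fun j _ => S j) ⟨y, hy⟩ (fun k _ z => lift k z) hj
  have hv0 : v i le_rfl = ⟨y, hy⟩ := by simp [v]
  have hv (j) (hj : i ≤ j) : v (j + 1) (hj.trans (Nat.le_succ j)) = lift j (v j hj) := by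
    simp [v, Nat.leRec_succ _ _ hj]
  obtain ⟨x, hx⟩ := (tiltDrop_bijective h i).2 ⟨fun j => (v j j.2 : QuotRing t I j), fun j hj => by
    exact (congrArg (frobProj h j ·.1) (hv j hj)).trans (hlift j _)⟩
  have hge (j) (hj : i ≤ j) : tiltProj h j x = v j hj :=
    congrFun (congrArg Subtype.val hx) ⟨j, hj⟩
  refine ⟨x, by rw [hge i le_rfl, hv0], ?_⟩
  have hle : ∀ k j, i ≤ j + k → tiltProj h j x ∈ S j := fun k => by
    induction k with
    | zero =>
      intro j hj
      rw [hge j hj]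
      exact (v j hj).2
    | succ k ih =>
      intro j hj
      rw [← frobProj_tiltProj, ← hS j]
      exact Set.mem_image_of_mem _ (ih (j + 1) (by omega))
  exact fun j => hle i j (by omega)

theorem tiltProj_surjective (hs : ∀ j, Function.Surjective (frobProj h j)) (i : ℕ) :
    Function.Surjective (tiltProj h i) := fun y => by
  obtain ⟨x, hx, -⟩ := exists_tiltProj_eq_and_forall_mem h (fun _ => Set.univ)
    (fun j => by rw [Set.image_univ, (hs j).range_eq]) i (Set.mem_univ y)
  exact ⟨x, hx⟩

/-- A sequence in the tilt each of whose coordinates is eventually constant converges. -/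
theorem exists_tiltProj_eq_of_eventually_const (s : ℕ → smallTilt h 0) (N : ℕ → ℕ)
    (hs : ∀ j n, N j ≤ n → tiltProj h j (s (n + 1)) = tiltProj h j (s n)) :
    ∃ L : smallTilt h 0, ∀ j n, N j ≤ n → tiltProj h j L = tiltProj h j (s n) := by
  have hconst (j n) (hn : N j ≤ n) : tiltProj h j (s n) = tiltProj h j (s (N j)) := by
    induction n, hn using Nat.le_induction with
    | base => rfl
    | succ n hn ih => rw [hs j n hn, ih]
  obtain ⟨L, hL⟩ := exists_tiltProj_eq h (fun j => tiltProj h j (s (N j))) fun j => by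
    rw [← hconst (j + 1) _ (le_max_right (N j) _), frobProj_tiltProj, hconst j _ (le_max_left _ _)]
  exact ⟨L, fun j n hn => by rw [hL, hconst j n hn]⟩

/-! ### The kernels of the projections of the tilt, and its completeness -/

/-- `g` is a distinguished element of the tilt: its `0`-th coordinate vanishes, and its
`(j + 1)`-st coordinate has a `p ^ j`-th power generating the kernel of `F_j`. -/
structure IsTiltUniformizer (g : smallTilt h 0) : Prop where
  tiltProj_zero : tiltProj h 0 g = 0
  ker_frobProj : ∀ j, RingHom.ker (frobProj h j) = Ideal.span {tiltProj h (j + 1) g ^ p ^ j}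

namespace IsTiltUniformizer

variable {h} {g : smallTilt h 0} (hg : IsTiltUniformizer h g)

include hg

theorem tiltProj_pow_eq_zero (j : ℕ) : tiltProj h j (g ^ p ^ j) = 0 := by
  induction j with
  | zero => rw [pow_zero, pow_one, hg.tiltProj_zero]
  | succ j ih => rw [pow_succ, pow_mul, map_pow, tiltProj_succ_pow, ih, map_zero]

theorem tiltProj_eq_zero_of_dvd {j : ℕ} {x : smallTilt h 0} (hx : g ^ p ^ j ∣ x) :
    tiltProj h j x = 0 :=
  zero_dvd_iff.mp ((hg.tiltProj_pow_eq_zero j).symm ▸ map_dvd (tiltProj h j) hx)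

/-- The approximation step for `ker_tiltProj`. -/
theorem exists_tiltProj_sub_mul_pow_eq_zero (hs : ∀ j, Function.Surjective (frobProj h j)) (j : ℕ)
    (x : smallTilt h 0) (hx : tiltProj h j x = 0) :
    ∃ z, tiltProj h (j + 1) (x - g ^ p ^ j * z) = 0 := by
  have h1 : tiltProj h (j + 1) x ∈ RingHom.ker (frobProj h j) := by
    rw [RingHom.mem_ker, frobProj_tiltProj, hx]
  rw [hg.ker_frobProj] at h1
  obtain ⟨w, hw⟩ := Ideal.mem_span_singleton.mp h1
  obtain ⟨z, rfl⟩ := tiltProj_surjective h hs _ w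
  exact ⟨z, by rw [map_sub, map_mul, map_pow, hw, sub_self]⟩

/-- Approximating an element of the kernel by multiples of `g ^ p ^ k`, `g ^ p ^ (k + 1)`, … writes
it as `g ^ p ^ k` times a convergent series. -/
theorem ker_tiltProj (hs : ∀ j, Function.Surjective (frobProj h j)) (k : ℕ) :
    RingHom.ker (tiltProj h k) = Ideal.span {g ^ p ^ k} := by
  refine le_antisymm (fun y hy => ?_) ((Ideal.span_singleton_le_iff_mem _).mpr
    (hg.tiltProj_pow_eq_zero k))
  have hp : 2 ≤ p := (Fact.out : p.Prime).two_le
  choose! z hz using hg.exists_tiltProj_sub_mul_pow_eq_zero hs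
  -- the successive remainders of `y`, which lie in smaller and smaller kernels
  let r : ℕ → smallTilt h 0 := fun n => Nat.rec y (fun n x => x - g ^ p ^ (k + n) * z (k + n) x) n
  have hr (n) : r (n + 1) = r n - g ^ p ^ (k + n) * z (k + n) (r n) := rfl
  have hr0 (n) : tiltProj h (k + n) (r n) = 0 := by
    induction n with
    | zero => exact hy
    | succ n ih => exact hz _ _ ih
  have hr0' (j n) (hjn : j ≤ k + n) : tiltProj h j (r n) = 0 := by
    have : ∀ m j, j + m = k + n → tiltProj h j (r n) = 0 := fun m => by
      induction m with
      | zero => rintro _ rfl; exact hr0 n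
      | succ m ih =>
        intro j hj
        rw [← frobProj_tiltProj, ih (j + 1) (by omega), map_zero]
    exact this (k + n - j) j (by omega)
  let s : ℕ → smallTilt h 0 := fun n =>
    ∑ m ∈ Finset.range n, g ^ (p ^ (k + m) - p ^ k) * z (k + m) (r m)
  have hys (n) : y = g ^ p ^ k * s n + r n := by
    induction n with
    | zero => simp [s, r]
    | succ n ih =>
      have h1 : p ^ (k + n) = p ^ k + (p ^ (k + n) - p ^ k) :=
        (Nat.add_sub_cancel' (Nat.pow_le_pow_right (by omega) (by omega))).symm
      simp only [s, Finset.sum_range_succ] at ih ⊢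
      rw [hr, mul_add, ← mul_assoc, ← pow_add, ← h1]
      nth_rewrite 1 [ih]
      ring
  obtain ⟨L, hL⟩ := exists_tiltProj_eq_of_eventually_const h s (fun j => j + 1) fun j n hn => by
    simp only [s, Finset.sum_range_succ, map_add]
    rw [hg.tiltProj_eq_zero_of_dvd (Dvd.dvd.mul_right (pow_dvd_pow g ?_) _), add_zero]
    obtain ⟨m, rfl⟩ : ∃ m, n = m + 1 := ⟨n - 1, by omega⟩
    have h1 : p ^ j ≤ p ^ (k + m) := Nat.pow_le_pow_right (by omega) (by omega)
    have h2 : p ^ k ≤ p ^ (k + m) := Nat.pow_le_pow_right (by omega) (by omega)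
    have h3 : p ^ (k + m) * 2 ≤ p ^ (k + (m + 1)) := by
      rw [← add_assoc, pow_succ]; exact Nat.mul_le_mul_left _ hp
    omega
  refine Ideal.mem_span_singleton.mpr ⟨L, tilt_ext fun j => ?_⟩
  nth_rewrite 1 [hys (j + 1)]
  rw [map_add, map_mul, map_mul, hL j (j + 1) le_rfl, hr0' j (j + 1) (by omega), add_zero]

theorem isAdicComplete (hs : ∀ j, Function.Surjective (frobProj h j)) :
    IsAdicComplete (Ideal.span {g}) (smallTilt h 0) := by
  have hp : 1 < p := (Fact.out : p.Prime).one_lt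
  have hmem (n : ℕ) (x : smallTilt h 0) :
      x ∈ (Ideal.span {g} ^ n • ⊤ : Ideal (smallTilt h 0)) ↔ g ^ n ∣ x := by
    rw [smul_eq_mul, Ideal.mul_top, Ideal.span_singleton_pow, Ideal.mem_span_singleton]
  refine { haus' := fun x hx => tilt_ext fun j => ?_, prec' := fun f hf => ?_ }
  · rw [map_zero]
    exact hg.tiltProj_eq_zero_of_dvd ((hmem _ x).mp (SModEq.zero.mp (hx _)))
  · have hdvd {m n} (hmn : m ≤ n) : g ^ m ∣ f m - f n := (hmem _ _).mp (SModEq.sub_mem.mp (hf hmn))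
    have hproj (j n) (hn : p ^ j ≤ n) : tiltProj h j (f (n + 1)) = tiltProj h j (f n) := by
      rw [eq_comm, ← sub_eq_zero, ← map_sub]
      exact hg.tiltProj_eq_zero_of_dvd ((pow_dvd_pow g hn).trans (hdvd n.le_succ))
    obtain ⟨L, hL⟩ := exists_tiltProj_eq_of_eventually_const h f (fun j => p ^ j) hproj
    refine ⟨L, fun n => SModEq.sub_mem.mpr ((hmem _ _).mpr ?_)⟩
    have h1 : f (p ^ n) - L ∈ RingHom.ker (tiltProj h n) := by
      rw [RingHom.mem_ker, map_sub, hL n _ le_rfl, sub_self]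
    rw [hg.ker_tiltProj hs, Ideal.mem_span_singleton] at h1
    have hn : n ≤ p ^ n := (Nat.lt_pow_self hp).le
    rw [← sub_add_sub_cancel _ (f (p ^ n)) L]
    exact dvd_add (hdvd hn) ((pow_dvd_pow g hn).trans h1)

theorem isNoetherianRing (hs : ∀ j, Function.Surjective (frobProj h j))
    [IsNoetherianRing (R 0)] : IsNoetherianRing (smallTilt h 0) := by
  have := hg.isAdicComplete hs
  have hker := hg.ker_tiltProj hs 0
  rw [pow_zero, pow_one] at hker
  have e := (Ideal.quotEquivOfEq hker).symm.trans
    (RingHom.quotientKerEquivOfSurjective (tiltProj_surjective h hs 0))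
  have := isNoetherianRing_of_ringEquiv _ e.symm
  exact isNoetherianRing_of_isAdicComplete_span_singleton g

end IsTiltUniformizer

end RingTower

namespace RingTower

universe u

variable {R : ℕ → Type u} [∀ i, CommRing (R i)] {t : ∀ i, R i →+* R (i + 1)}
  {p : ℕ} {I : Ideal (R 0)}

/-! ### Torsion in a perfectoid tower and in its tilt -/

/-- The image in `R_i` of an element of `R 0`. -/
def towerElem (t : ∀ i, R i →+* R (i + 1)) (f : R 0) (i : ℕ) : R i :=
  towerMap t 0 (Nat.zero_le i) f

theorem map_towerElem (f : R 0) (i : ℕ) : t i (towerElem t f i) = towerElem t f (i + 1) := by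
  rw [towerElem, towerElem, towerMap_succ t (Nat.zero_le i), RingHom.comp_apply]

theorem extIdeal_span_singleton (f : R 0) (i : ℕ) :
    extIdeal t (Ideal.span {f}) i = Ideal.span {towerElem t f i} := by
  rw [extIdeal, Ideal.map_span, Set.image_singleton]
  rfl

variable [Fact p.Prime]

namespace IsPerfectoid

variable (h : IsPerfectoid t p I)

include h

theorem torsionAt_eq_torsionBy {f : R 0} (hf : I = Ideal.span {f}) (i : ℕ) :
    torsionAt t I i = Submodule.torsionBy (R i) (R i) (towerElem t f i) := by
  apply le_antisymm
  · intro x hx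
    rw [Submodule.mem_torsionBy_iff, smul_eq_mul, ← Submodule.mem_bot (R i),
      ← h.ideal_mul_torsion i]
    refine Ideal.mul_mem_mul ?_ hx
    rw [hf, extIdeal_span_singleton]
    exact Ideal.mem_span_singleton_self _
  · intro x hx a ha
    rw [Submodule.mem_torsionBy_iff, smul_eq_mul] at hx
    rw [hf] at ha
    obtain ⟨r, rfl⟩ := Ideal.mem_span_singleton.mp ha
    refine ⟨1, one_pos, ?_⟩
    rw [pow_one, map_mul, mul_right_comm]
    exact mul_eq_zero_of_left hx _

theorem towerElem_mul_eq_zero {f : R 0} (hf : I = Ideal.span {f}) {i : ℕ} {x : R i}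
    (hx : towerElem t f i * (towerElem t f i * x) = 0) : towerElem t f i * x = 0 := by
  have h1 : x ∈ torsionAt t I i := by
    intro a ha
    rw [hf] at ha
    obtain ⟨r, rfl⟩ := Ideal.mem_span_singleton.mp ha
    refine ⟨2, two_pos, ?_⟩
    rw [map_mul]
    change (towerElem t f i * _) ^ 2 * x = 0
    linear_combination (towerMap t 0 (Nat.zero_le i) r) ^ 2 * hx
  rw [h.torsionAt_eq_torsionBy hf] at h1
  exact h1

/-- The torsion of `R_i` embeds into `R_i / I R_i`. -/
theorem eq_zero_of_mem_torsionAt_of_mk_eq_zero {i : ℕ} {x : R i} (hx : x ∈ torsionAt t I i)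
    (hx0 : Ideal.Quotient.mk (extIdeal t I i) x = 0) : x = 0 := by
  obtain ⟨f, hf⟩ := h.principal
  rw [Ideal.Quotient.eq_zero_iff_mem] at hx0
  have hI : I = Ideal.span {f} := hf
  rw [h.torsionAt_eq_torsionBy hI, Submodule.mem_torsionBy_iff, smul_eq_mul] at hx
  subst hI
  rw [extIdeal_span_singleton] at hx0
  obtain ⟨d, rfl⟩ := Ideal.mem_span_singleton.mp hx0
  exact h.towerElem_mul_eq_zero rfl hx

/-- Together with `eq_zero_of_mem_map_torsionAt_of_frobProj_eq_zero`, this says that `F_i` is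
bijective between the images of the torsion of `R_{i+1}` and of `R_i` in their reductions. -/
theorem frobProj_image_map_torsionAt (i : ℕ) :
    frobProj h.toIsPurelyInseparable i ''
      ((torsionAt t I (i + 1)).map (Ideal.Quotient.mk (extIdeal t I (i + 1))) : Set _) =
      ((torsionAt t I i).map (Ideal.Quotient.mk (extIdeal t I i)) : Set _) := by
  obtain ⟨e, he, hF⟩ := h.exists_torsion_bijection i
  ext y
  constructor
  · rintro ⟨z, hz, rfl⟩
    obtain ⟨x, hx, rfl⟩ := (Ideal.mem_map_iff_of_surjective _ Ideal.Quotient.mk_surjective).mp hz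
    rw [← hF ⟨x, hx⟩]
    exact Ideal.mem_map_of_mem _ (e _).2
  · intro hy
    obtain ⟨x, hx, rfl⟩ := (Ideal.mem_map_iff_of_surjective _ Ideal.Quotient.mk_surjective).mp hy
    obtain ⟨z, hz⟩ := he.2 ⟨x, hx⟩
    refine ⟨_, Ideal.mem_map_of_mem _ z.2, ?_⟩
    rw [← hF, hz]

theorem eq_zero_of_mem_map_torsionAt_of_frobProj_eq_zero {i : ℕ} {y : QuotRing t I (i + 1)}
    (hy : y ∈ (torsionAt t I (i + 1)).map (Ideal.Quotient.mk (extIdeal t I (i + 1))))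
    (hy0 : frobProj h.toIsPurelyInseparable i y = 0) : y = 0 := by
  obtain ⟨e, he, hF⟩ := h.exists_torsion_bijection i
  obtain ⟨x, hx, rfl⟩ := (Ideal.mem_map_iff_of_surjective _ Ideal.Quotient.mk_surjective).mp hy
  have h0 (z : torsionAt t I (i + 1)) (hz : frobProj h.toIsPurelyInseparable i
      (Ideal.Quotient.mk (extIdeal t I (i + 1)) z) = 0) : e z = 0 :=
    Subtype.ext (h.eq_zero_of_mem_torsionAt_of_mk_eq_zero (e z).2 ((hF z).trans hz))
  have h1 : (⟨x, hx⟩ : torsionAt t I (i + 1)) = 0 :=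
    he.1 ((h0 _ hy0).trans (h0 0 (by simp)).symm)
  rw [show x = 0 from congrArg Subtype.val h1, map_zero]

/-- The tilt has a uniformizer `g`; its coordinate in `R_{i+1} / I R_{i+1}` has the property that the
`p ^ (i + 1)`-st power of any lift to `R_{i+1}` generates `I R_{i+1}`. -/
theorem exists_isTiltUniformizer : ∃ g : smallTilt h.toIsPurelyInseparable 0,
    IsTiltUniformizer h.toIsPurelyInseparable g ∧
    ∀ (i : ℕ) (y : R (i + 1)), Ideal.Quotient.mk _ y = tiltProj h.toIsPurelyInseparable (i + 1) g →
      extIdeal t I (i + 1) = Ideal.span {y ^ p ^ (i + 1)} := by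
  set h' := h.toIsPurelyInseparable
  have hp : 1 < p := (Fact.out : p.Prime).one_lt
  obtain ⟨I₁, ⟨f₁, hf₁⟩, hpow, hker⟩ := h.exists_pillar
  have hI₁ : I₁ = Ideal.span {f₁} := hf₁
  let c (i : ℕ) : R (i + 1) := towerMap t 1 (Nat.le_add_left 1 i) f₁
  have hkerc (i) : RingHom.ker (frobProj h' i) = Ideal.span {Ideal.Quotient.mk _ (c i)} := by
    rw [hker, hI₁, Ideal.map_span, Ideal.map_span, Set.image_singleton, Set.image_singleton]
  have hext (i) : extIdeal t I (i + 1) = Ideal.span {c i ^ p} := by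
    have h1 : extIdeal t I (i + 1) = (extIdeal t I 1).map (towerMap t 1 (Nat.le_add_left 1 i)) := by
      rw [extIdeal, extIdeal, Ideal.map_map, towerMap_comp_towerMap]
    rw [h1, ← hpow, hI₁, Ideal.span_singleton_pow, Ideal.map_span, Set.image_singleton, map_pow]
  have hc (i) : quotMap t I (i + 1) (Ideal.Quotient.mk _ (c i)) =
      Ideal.Quotient.mk _ (c (i + 1)) := by
    change Ideal.Quotient.mk _ (t (i + 1) (c i)) = _
    exact congrArg _ (RingHom.congr_fun (towerMap_succ t (Nat.le_add_left 1 i)).symm f₁)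
  obtain ⟨g, hg⟩ := tiltProj_surjective h' h.frobProj_surjective 1 (Ideal.Quotient.mk _ (c 0))
  have hgc (i) : tiltProj h' (i + 1) g ^ p ^ i = Ideal.Quotient.mk _ (c i) := by
    induction i with
    | zero => rw [pow_zero, pow_one, hg]
    | succ i ih =>
      rw [pow_succ', pow_mul, tiltProj_succ_pow, ← map_pow, ih, hc]
  refine ⟨g, ⟨?_, fun j => by rw [hkerc, hgc]⟩, fun i y hy => ?_⟩
  · rw [← frobProj_tiltProj, ← RingHom.mem_ker, hkerc, hg]
    exact Ideal.mem_span_singleton_self _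
  · have hgi := hgc i
    rw [← hy, ← map_pow, Ideal.Quotient.eq, hext] at hgi
    obtain ⟨d, hd⟩ := Ideal.mem_span_singleton.mp hgi
    have hcj : c i ∈ (⊥ : Ideal (R (i + 1))).jacobson := Ideal.isRadical_jacobson _
      ⟨p, h.zariskian (i + 1) (by rw [hext]; exact Ideal.mem_span_singleton_self _)⟩
    -- `y ^ p ^ i` and `c i` differ by a unit: they are congruent modulo `c i ^ p`, and `2 ≤ p`.
    have hu := Ideal.mem_jacobson_bot.mp hcj (c i ^ (p - 2) * d)
    have hyu : y ^ p ^ i = c i * (c i * (c i ^ (p - 2) * d) + 1) := by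
      obtain ⟨q, rfl⟩ : ∃ q, p = q + 2 := ⟨p - 2, by omega⟩
      rw [Nat.add_sub_cancel]
      linear_combination hd
    rw [hext, pow_succ, pow_mul, hyu, mul_pow,
      Ideal.span_singleton_mul_right_unit (hu.pow p)]

/-- The torsion of `R_i` and the `g`-torsion of the tilt have the same image in `R_i / I R_i`. For
the inclusion of the former in the latter, a torsion class is lifted to an element `x` of the tilt
whose coordinates are all torsion classes; then those of `g * x` are torsion classes too, and vanish
because the `0`-th one does and the `F_j` are injective on torsion classes. -/
theorem exists_isTiltUniformizer_and_map_torsionBy :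
    ∃ g : smallTilt h.toIsPurelyInseparable 0, IsTiltUniformizer h.toIsPurelyInseparable g ∧
    ∀ i, Ideal.map (tiltProj h.toIsPurelyInseparable i) (Submodule.torsionBy _ _ (g ^ p ^ i)) =
      (torsionAt t I i).map (Ideal.Quotient.mk (extIdeal t I i)) := by
  obtain ⟨g, hg, hext⟩ := h.exists_isTiltUniformizer
  refine ⟨g, hg, fun i => ?_⟩
  have hp : 2 ≤ p := (Fact.out : p.Prime).two_le
  obtain ⟨f, hf⟩ := h.principal
  have hI : I = Ideal.span {f} := hf
  apply le_antisymm
  · rw [Ideal.map_le_iff_le_comap]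
    intro x hx
    have hgx : g * x = 0 := by
      refine pow_eq_zero_iff (pow_ne_zero i (by omega : p ≠ 0)) |>.mp ?_
      rw [mul_pow, ← Nat.sub_add_cancel (Nat.one_le_pow i p (by omega)), pow_succ x,
        ← mul_assoc, mul_right_comm, Nat.sub_add_cancel (Nat.one_le_pow i p (by omega))]
      exact mul_eq_zero_of_left ((Submodule.mem_torsionBy_iff _ _).mp hx) _
    obtain ⟨x', hx'⟩ := Ideal.Quotient.mk_surjective (tiltProj h.1 (i + 1) x)
    obtain ⟨y, hy⟩ := Ideal.Quotient.mk_surjective (tiltProj h.1 (i + 1) g)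
    have hmem : y * x' ∈ extIdeal t I (i + 1) := by
      rw [← Ideal.Quotient.eq_zero_iff_mem, map_mul, hx', hy, ← map_mul, hgx, map_zero]
    rw [hext i y hy] at hmem
    obtain ⟨d, hd⟩ := Ideal.mem_span_singleton.mp hmem
    have hpow : p ^ (i + 1) = (p ^ (i + 1) - 1) + 1 :=
      (Nat.sub_add_cancel (Nat.one_le_pow _ p (by omega))).symm
    -- `x'` is torsion up to a multiple of a power of `y` that dies in `R_i / I R_i`.
    have htor : x' - y ^ (p ^ (i + 1) - 1) * d ∈ torsionAt t I (i + 1) := by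
      rw [h.torsionAt_eq_torsionBy hI, Submodule.mem_torsionBy_iff, smul_eq_mul]
      have hfy : towerElem t f (i + 1) ∈ Ideal.span {y ^ p ^ (i + 1)} := by
        rw [← hext i y hy, hI, extIdeal_span_singleton]
        exact Ideal.mem_span_singleton_self _
      obtain ⟨r, hr⟩ := Ideal.mem_span_singleton.mp hfy
      have h0 : y * (x' - y ^ (p ^ (i + 1) - 1) * d) = 0 := by
        rw [mul_sub, hd, ← mul_assoc, ← pow_succ', ← hpow, sub_self]
      have hy1 : y ^ p ^ (i + 1) = y ^ (p ^ (i + 1) - 1) * y := by rw [← pow_succ, ← hpow]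
      rw [hr, hy1]
      linear_combination y ^ (p ^ (i + 1) - 1) * r * h0
    have h1 := (h.frobProj_image_map_torsionAt i).le
      (Set.mem_image_of_mem _ (Ideal.mem_map_of_mem (Ideal.Quotient.mk _) htor))
    have hle : p ^ i ≤ p ^ (i + 1) - 1 := by
      have := Nat.one_le_pow i p (by omega)
      have : p ^ i * 2 ≤ p ^ (i + 1) := by rw [pow_succ]; exact Nat.mul_le_mul_left _ hp
      omega
    rwa [map_sub, map_mul, map_pow, hx', hy, map_sub, map_mul, map_pow, frobProj_tiltProj,
      frobProj_tiltProj, ← map_pow, hg.tiltProj_eq_zero_of_dvd (pow_dvd_pow g hle), zero_mul,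
      sub_zero] at h1
  · intro y hy
    obtain ⟨x, rfl, hx⟩ := exists_tiltProj_eq_and_forall_mem h.1
      (fun j => ((torsionAt t I j).map (Ideal.Quotient.mk (extIdeal t I j)) : Set _))
      h.frobProj_image_map_torsionAt i hy
    refine Ideal.mem_map_of_mem _ ?_
    have hgx : g * x = 0 := tilt_ext fun j => by
      rw [map_zero]
      induction j with
      | zero => rw [map_mul, hg.tiltProj_zero, zero_mul]
      | succ j ih =>
        refine h.eq_zero_of_mem_map_torsionAt_of_frobProj_eq_zero ?_
          ((frobProj_tiltProj h.1 j _).trans ih)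
        rw [map_mul]
        exact Ideal.mul_mem_left _ _ (hx (j + 1))
    rw [Submodule.mem_torsionBy_iff, smul_eq_mul,
      ← Nat.sub_add_cancel (Nat.one_le_pow i p (by omega)), pow_succ, mul_assoc, hgx, mul_zero]

/-- The transition map `t i` and the Frobenius of the tilt have the same reduction
`R_i / I R_i → R_{i+1} / I R_{i+1}`, and their torsion has the same image there. -/
theorem flat_iff_flat_powHom (hN : ∀ i, IsNoetherianRing (R i)) (i : ℕ) :
    (t i).Flat ↔ (powHom (natCast_smallTilt_eq_zero h.toIsPurelyInseparable 0)).Flat := by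
  obtain ⟨g, hg, hmap⟩ := h.exists_isTiltUniformizer_and_map_torsionBy
  obtain ⟨f, hf⟩ := h.principal
  have hI : I = Ideal.span {f} := hf
  have hs := h.frobProj_surjective
  have hgpow : powHom (natCast_smallTilt_eq_zero h.1 0) (g ^ p ^ i) = g ^ p ^ (i + 1) :=
    (pow_mul g _ p).symm
  have hker (j) : RingHom.ker (Ideal.Quotient.mk (extIdeal t I j)) =
      Ideal.span {towerElem t f j} := by
    rw [Ideal.mk_ker, hI, extIdeal_span_singleton]
  have := hg.isNoetherianRing hs
  have := hg.isAdicComplete hs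
  have hp : p ≠ 0 := (Fact.out : p.Prime).ne_zero
  rw [RingHom.flat_iff_flat_mod_and_torsionBy_le (t i) (quotMap t I i)
      (Ideal.Quotient.mk _) (Ideal.Quotient.mk _) Ideal.Quotient.mk_surjective
      Ideal.Quotient.mk_surjective rfl (towerElem t f i) (hker i)
      (by rw [map_towerElem, hker]) ?_
      (fun b hb => by rw [map_towerElem] at hb ⊢; exact h.towerElem_mul_eq_zero hI hb),
    RingHom.flat_iff_flat_mod_and_torsionBy_le (powHom (natCast_smallTilt_eq_zero h.1 0))
      (quotMap t I i) (tiltProj h.1 i) (tiltProj h.1 (i + 1)) (tiltProj_surjective h.1 hs i)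
      (tiltProj_surjective h.1 hs (i + 1))
      (RingHom.ext fun x => (map_pow _ x p).trans (tiltProj_succ_pow h.1 i x)) (g ^ p ^ i)
      (hg.ker_tiltProj hs i) (by rw [hgpow, hg.ker_tiltProj hs]) ?_ fun b hb => ?_,
    hgpow, hmap, hmap, map_towerElem, ← h.torsionAt_eq_torsionBy hI, ← h.torsionAt_eq_torsionBy hI]
  · rw [hgpow]
    exact Ideal.pow_mem_of_mem _ (IsAdicComplete.le_jacobson_bot (Ideal.span {g})
      (Ideal.mem_span_singleton_self g)) _ (pow_pos hp.bot_lt _)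
  · refine pow_eq_zero_iff two_ne_zero |>.mp ?_
    linear_combination b * hb
  · rw [map_towerElem]
    refine h.zariskian (i + 1) ?_
    rw [hI, extIdeal_span_singleton]
    exact Ideal.mem_span_singleton_self _

end IsPerfectoid
end RingTower

/-! ### Flatness of a perfectoid tower and of its tilt -/

theorem mainTheorem4 {p : ℕ} [Fact p.Prime] {R : ℕ → Type*} [∀ i, CommRing (R i)]
    (t : ∀ i, R i →+* R (i + 1)) (I₀ : Ideal (R 0))
    (h : RingTower.IsPerfectoid t p I₀) (hN : ∀ i, IsNoetherianRing (R i)) :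
    (∀ i, (t i).Flat ↔ (RingTower.smallTiltMap h.toIsPurelyInseparable i).Flat) ∧
      ((∃ i, (t i).Flat) → ∀ i, (t i).Flat) := by
  refine ⟨fun i => ?_, fun ⟨j, hj⟩ i => ?_⟩
  · rw [h.flat_iff_flat_powHom hN, RingTower.flat_smallTiltMap_iff]
  · rwa [h.flat_iff_flat_powHom hN, ← h.flat_iff_flat_powHom hN j]
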